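/- Let $\Sigma$ be a finite alphabet. A straight line program (SLP) of size $n\ge 1$ over $\Sigma$ is a sequence of assignments $X_i\to \mathit{expr}_i$ ($1\le i\le n$), where each $\mathit{expr}_i$ is either a letter of $\Sigma$ or a product $X_\ell X_r$ with $\ell,r<i$; it represents the string $S$ derived from $X_n$. The LZ78 factorization of $S$ is the factorization $S=f_1\cdots f_m$ such that for every $i=1,\dots,m$ the factor $f_i$ is the longest prefix of $f_i\cdots f_m$ that belongs to $F_i$, where $F_1=\Sigma$ and $F_{i+1}=F_i\cup\{f_i\,f_{i+1}[1]\}$, with $f_{i+1}[1]$ the first letter of $f_{i+1}$. Its size is $m$, and it is output as the sequence of the IDs of the $f_i$ in $F_i$: an ID names either a letter or an entry $f_k f_{k+1}[1]$ by its number $k<i$. There is an algorithm which, given an SLP of size $n$ that represents a string $S$, computes the LZ78 factorization of $S$ in $O(n^3m^2)$ time, where $m$ is the size of this factorization. The algorithm runs on a word RAM on which operations on words take constant time and whose word size $w$ is at least logarithmic in $|S|$, so that $|S|$, the size $n$ and the (numbered) letters of $\Sigma$ fit in a word: $|S|<2^w$, $n<2^w$, $|\Sigma|\le 2^w$. The algorithm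 and the constant in the $O$-bound do not depend on the SLP, on $\Sigma$ or on $w$. -/

import Mathlib

/-! ### Straight line programs -/

/-- The right-hand side of the `i`-th assignment: a letter, or a product of two
variables with indices smaller than `i`. -/
inductive SLP.Expr (α : Type) (i : ℕ) : Type
  | letter (a : α) : SLP.Expr α i
  | pair (l r : Fin i) : SLP.Expr α i

/-- A straight line program over the alphabet `α`: a nonempty sequence of assignments
`X_i → expr_i`, indexed from `0`. Its size is the number of assignments. -/
structure SLP (α : Type) : Type where
  size : ℕ
  size_pos : 0 < size
  rule : (i : Fin size) → SLP.Expr α i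

namespace SLP

variable {α : Type}

/-- The string derived from the variable `X_i`. -/
def val (G : SLP α) (i : ℕ) (hi : i < G.size) : List α :=
  match G.rule ⟨i, hi⟩ with
  | .letter a => [a]
  | .pair l r => G.val l (l.isLt.trans hi) ++ G.val r (r.isLt.trans hi)
termination_by i
decreasing_by
  · exact l.isLt
  · exact r.isLt

/-- The string represented by the program: the value of its last variable. -/
def str (G : SLP α) : List α :=
  G.val (G.size - 1) (Nat.sub_lt G.size_pos Nat.one_pos)

end SLP

/-! ### The LZ78 factorization

Factors are indexed from `0`: the list `fs` holds `f_1, …, f_m` at the places `0, …, m - 1`. -/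

namespace LZ78

variable {α : Type}

/-- The dictionary entry `f_k f_{k+1}[1]`: a factor followed by the first letter of the
next factor. -/
def entry (fs : List (List α)) (k : ℕ) : List α :=
  fs.getD k [] ++ (fs.getD (k + 1) []).take 1

/-- The dictionaries: the first one is the alphabet, and each following one has one entry
more. -/
def dict (fs : List (List α)) : ℕ → Set (List α)
  | 0 => {x | ∃ a : α, x = [a]}
  | i + 1 => dict fs i ∪ {entry fs i}

/-- `fs` is the LZ78 factorization of `S`: it is a factorization of `S`, and every factor is
the longest prefix of the remaining suffix that lies in the current dictionary. -/
def IsFactorization (S : List α) (fs : List (List α)) : Prop :=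
  fs.flatten = S ∧
    ∀ (i : ℕ) (hi : i < fs.length),
      fs[i] ∈ dict fs i ∧
        ∀ g ∈ dict fs i, g <+: (fs.drop i).flatten → g.length ≤ fs[i].length

/-- IDs of dictionary elements: a letter, or the number `k` of an entry. -/
inductive Id (α : Type) : Type
  | letter (a : α) : Id α
  | entry (k : ℕ) : Id α

/-- `x` is the ID of the string `f` in the `i`-th dictionary, which consists of the letters
and the entries with numbers `k < i`. -/
def Id.Denotes (fs : List (List α)) (i : ℕ) (f : List α) : Id α → Prop
  | .letter a => f = [a]
  | .entry k => k < i ∧ f = LZ78.entry fs k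

/-- `ids` is the sequence of the IDs of the factors in their dictionaries. -/
def IsEncoding (fs : List (List α)) (ids : List (Id α)) : Prop :=
  List.length ids = List.length fs ∧
    ∀ (i : ℕ) (hi : i < fs.length) (hi' : i < ids.length), ids[i].Denotes fs i fs[i]

end LZ78

/-! ### A word RAM

Programs are while programs over registers and arrays, both named by natural numbers in the
program text, so that a program uses finitely many of them. All values are words, that is,
natural numbers below `W = 2 ^ w` for the word size `w`, and an array is indexed by a word. -/

namespace RAM

/-- Operations on words that take constant time. -/
inductive Op : Type
  | add | sub | mul | div | mod | lt | eq

/-- Results are reduced modulo `W`; subtraction is truncated at `0`, division by `0` yields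
`0`, and comparisons yield `1` or `0`. -/
def Op.eval (W : ℕ) : Op → ℕ → ℕ → ℕ
  | .add, a, b => (a + b) % W
  | .sub, a, b => (a - b) % W
  | .mul, a, b => (a * b) % W
  | .div, a, b => (a / b) % W
  | .mod, a, b => (a % b) % W
  | .lt, a, b => (if a < b then 1 else 0) % W
  | .eq, a, b => (if a = b then 1 else 0) % W

/-- Contents of the registers and of the arrays. -/
@[ext]
structure State : Type where
  reg : ℕ → ℕ
  arr : ℕ → ℕ → ℕ

def State.setReg (s : State) (x v : ℕ) : State :=
  { s with reg := Function.update s.reg x v }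

def State.setArr (s : State) (b j v : ℕ) : State :=
  { s with arr := Function.update s.arr b (Function.update (s.arr b) j v) }

/-- Expressions: constants, registers, array cells, operations. -/
inductive Expr : Type
  | const (c : ℕ) : Expr
  | reg (x : ℕ) : Expr
  | read (b : ℕ) (e : Expr) : Expr
  | op (o : Op) (e₁ e₂ : Expr) : Expr

def Expr.eval (W : ℕ) (s : State) : Expr → ℕ
  | .const c => c % W
  | .reg x => s.reg x
  | .read b e => s.arr b (e.eval W s)
  | .op o e₁ e₂ => o.eval W (e₁.eval W s) (e₂.eval W s)

/-- The time to evaluate an expression: one step for each of its nodes. -/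
def Expr.cost : Expr → ℕ
  | .const _ => 1
  | .reg _ => 1
  | .read _ e => e.cost + 1
  | .op _ e₁ e₂ => e₁.cost + e₂.cost + 1

/-- Programs. `write b e₁ e₂` stores the value of `e₂` in the cell `e₁` of the array `b`. -/
inductive Cmd : Type
  | skip : Cmd
  | assign (x : ℕ) (e : Expr) : Cmd
  | write (b : ℕ) (e₁ e₂ : Expr) : Cmd
  | seq (c₁ c₂ : Cmd) : Cmd
  | ite (e : Expr) (c₁ c₂ : Cmd) : Cmd
  | while (e : Expr) (c : Cmd) : Cmd

/-- `Exec W c s s' t`: started in the state `s`, the program `c` halts in the state `s'` after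
exactly `t` steps. A condition holds if its value is not `0`. -/
inductive Exec (W : ℕ) : Cmd → State → State → ℕ → Prop
  | skip (s : State) : Exec W .skip s s 1
  | assign (x : ℕ) (e : Expr) (s : State) :
      Exec W (.assign x e) s (s.setReg x (e.eval W s)) (e.cost + 1)
  | write (b : ℕ) (e₁ e₂ : Expr) (s : State) :
      Exec W (.write b e₁ e₂) s (s.setArr b (e₁.eval W s) (e₂.eval W s))
        (e₁.cost + e₂.cost + 1)
  | seq {c₁ c₂ : Cmd} {s s' s'' : State} {t₁ t₂ : ℕ} :
      Exec W c₁ s s' t₁ → Exec W c₂ s' s'' t₂ → Exec W (.seq c₁ c₂) s s'' (t₁ + t₂)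
  | ite_true {e : Expr} {c₁ c₂ : Cmd} {s s' : State} {t : ℕ} :
      e.eval W s ≠ 0 → Exec W c₁ s s' t → Exec W (.ite e c₁ c₂) s s' (e.cost + 1 + t)
  | ite_false {e : Expr} {c₁ c₂ : Cmd} {s s' : State} {t : ℕ} :
      e.eval W s = 0 → Exec W c₂ s s' t → Exec W (.ite e c₁ c₂) s s' (e.cost + 1 + t)
  | while_true {e : Expr} {c : Cmd} {s s' s'' : State} {t₁ t₂ : ℕ} :
      e.eval W s ≠ 0 → Exec W c s s' t₁ → Exec W (.while e c) s' s'' t₂ →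
        Exec W (.while e c) s s'' (e.cost + 1 + t₁ + t₂)
  | while_false {e : Expr} {c : Cmd} {s : State} :
      e.eval W s = 0 → Exec W (.while e c) s s (e.cost + 1)

end RAM

/-! ### Input and output format -/

/-- The three words that describe the right-hand side of an assignment:
`0, a, 0` for a letter `a`, and `1, l, r` for a product `X_l X_r`. -/
def SLP.Expr.word {σ i : ℕ} : SLP.Expr (Fin σ) i → Fin 3 → ℕ
  | .letter a => ![0, a, 0]
  | .pair l r => ![1, l, r]

/-- The initial state for an input program of size `n`: register `0` holds `n`, the arrays `0`,
`1` and `2` hold at index `i` the three words of the `i`-th assignment, and everything else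
is `0`. -/
def SLP.initState {σ : ℕ} (G : SLP (Fin σ)) : RAM.State where
  reg x := if x = 0 then G.size else 0
  arr b i := if h : b < 3 ∧ i < G.size then (G.rule ⟨i, h.2⟩).word ⟨b, h.1⟩ else 0

/-- The two words that describe an ID: `0, a` for a letter `a`, and `1, k` for the entry with
number `k`. -/
def LZ78.Id.word {σ : ℕ} : LZ78.Id (Fin σ) → Fin 2 → ℕ
  | .letter a => ![0, a]
  | .entry k => ![1, k]

/-- The state holds the sequence `ids` as its output: its length is in register `1`, and the two
words of the `i`-th ID are in the arrays `3` and `4` at index `i`. -/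
def RAM.State.Outputs {σ : ℕ} (s : RAM.State) (ids : List (LZ78.Id (Fin σ))) : Prop :=
  s.reg 1 = ids.length ∧
    ∀ (i : ℕ) (hi : i < ids.length), s.arr 3 i = ids[i].word 0 ∧ s.arr 4 i = ids[i].word 1

/-! The length of a text is at most the square of the number `m` of its LZ78 factors, so that it
suffices to process the text letter by letter in time `O(n)` for each letter: the letter is read by a
descent in the grammar, and the dictionary is a trie with linked lists of at most `n` children. -/

/-! ### Timed total correctness for RAM programs -/

/-! Write `n` for the size of the program, `N` for the length of the text and `m` for the number of
factors. A factor is a letter or an earlier factor plus one letter, so the `i`-th factor has length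
at most `i` (counted from one) and `N ≤ m ^ 2` (`Greedy.length_flatten_le`). Hence plain online LZ78
parsing of the decompressed text, at `O(n)` per letter, takes time `O(n * N)`, which is within `O(n
^ 3 * m ^ 2)`.

Reading a letter is a descent in the grammar along strictly decreasing variables
(`runs_readLetter`). The dictionary is a trie whose siblings carry distinct letters of the text; at
most `n` letters occur in the rules, so scanning a sibling list is `O(n)` for every alphabet size
(`Greedy.length_children_le`, `runs_searchChild`).

Greedy parsing is correct because of the invariant `Greedy`: every factor has an ID in its
dictionary, and the entry it creates is not yet in that dictionary. As dictionaries are closed under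
nonempty prefixes, the second property rules out a longer choice of factor
(`Greedy.isFactorization`). -/

namespace RAM

/-- Started in `s`, the program halts within `T` steps in a state that satisfies `Q`. -/
def Runs (W : ℕ) (c : Cmd) (s : State) (T : ℕ) (Q : State → Prop) : Prop :=
  ∃ s' t, Exec W c s s' t ∧ t ≤ T ∧ Q s'

variable {W : ℕ} {c c₁ c₂ : Cmd} {s : State} {T T' T₁ T₂ : ℕ} {Q Q' : State → Prop} {e e₁ e₂ : Expr}

theorem Runs.mono (h : Runs W c s T Q) (hT : T ≤ T') (hQ : ∀ s', Q s' → Q' s') :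
    Runs W c s T' Q' := by
  obtain ⟨s', t, h₁, h₂, h₃⟩ := h
  exact ⟨s', t, h₁, h₂.trans hT, hQ _ h₃⟩

theorem Runs.assign {x : ℕ} (hT : e.cost + 1 ≤ T) (h : Q (s.setReg x (e.eval W s))) :
    Runs W (.assign x e) s T Q :=
  ⟨_, _, .assign x e s, hT, h⟩

theorem Runs.write {b : ℕ} (hT : e₁.cost + e₂.cost + 1 ≤ T)
    (h : Q (s.setArr b (e₁.eval W s) (e₂.eval W s))) : Runs W (.write b e₁ e₂) s T Q :=
  ⟨_, _, .write b e₁ e₂ s, hT, h⟩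

theorem Runs.seq (h₁ : Runs W c₁ s T₁ Q') (h₂ : ∀ s', Q' s' → Runs W c₂ s' T₂ Q)
    (hT : T₁ + T₂ ≤ T) : Runs W (.seq c₁ c₂) s T Q := by
  obtain ⟨s₁, t₁, e₁, l₁, q₁⟩ := h₁
  obtain ⟨s₂, t₂, e₂, l₂, q₂⟩ := h₂ s₁ q₁
  exact ⟨s₂, _, .seq e₁ e₂, by omega, q₂⟩

/-- With the exact successor state as intermediate assertion, straight-line code is executed
symbolically. -/
theorem Runs.assign_seq {x : ℕ} (h : Runs W c (s.setReg x (e.eval W s)) T' Q)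
    (hT : e.cost + 1 + T' ≤ T) : Runs W (.seq (.assign x e) c) s T Q :=
  Runs.seq (Q' := (· = s.setReg x (e.eval W s))) (Runs.assign le_rfl rfl) (fun _ h' => h' ▸ h) hT

theorem Runs.write_seq {b : ℕ} (h : Runs W c (s.setArr b (e₁.eval W s) (e₂.eval W s)) T' Q)
    (hT : e₁.cost + e₂.cost + 1 + T' ≤ T) : Runs W (.seq (.write b e₁ e₂) c) s T Q :=
  Runs.seq (Q' := (· = s.setArr b (e₁.eval W s) (e₂.eval W s))) (Runs.write le_rfl rfl)
    (fun _ h' => h' ▸ h) hT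

theorem Runs.ite (h₁ : e.eval W s ≠ 0 → Runs W c₁ s T' Q) (h₂ : e.eval W s = 0 → Runs W c₂ s T' Q)
    (hT : e.cost + 1 + T' ≤ T) : Runs W (.ite e c₁ c₂) s T Q := by
  by_cases h : e.eval W s = 0
  · obtain ⟨s', t, a, b, d⟩ := h₂ h
    exact ⟨s', _, .ite_false h a, by omega, d⟩
  · obtain ⟨s', t, a, b, d⟩ := h₁ h
    exact ⟨s', _, .ite_true h a, by omega, d⟩

/-- The rule for loops, for an invariant `I` that is indexed by a bound on the number of
iterations that are left. -/
theorem Runs.while {I : ℕ → State → Prop}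
    (h : ∀ k s, I k s → e.eval W s ≠ 0 → Runs W c s T (fun s' => ∃ k' < k, I k' s')) :
    ∀ k s, I k s → Runs W (.while e c) s ((k + 1) * (e.cost + 1 + T))
      (fun s' => e.eval W s' = 0 ∧ ∃ k, I k s') := by
  intro k
  induction k using Nat.strong_induction_on with
  | _ k ih =>
    intro s hs
    by_cases h0 : e.eval W s = 0
    · exact ⟨s, _, .while_false h0, by nlinarith [Nat.zero_le (k * (e.cost + 1 + T))], h0, k, hs⟩
    · obtain ⟨s₁, t₁, x₁, l₁, k', hk', hI⟩ := h k s hs h0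
      obtain ⟨s₂, t₂, x₂, l₂, q₂⟩ := ih k' hk' s₁ hI
      refine ⟨s₂, _, .while_true h0 x₁ x₂, ?_, q₂⟩
      -- The bound drops by at least one, which pays for this iteration; the extra `1` in `k + 1`
      -- covers the final failing test.
      have : (k' + 1) * (e.cost + 1 + T) ≤ k * (e.cost + 1 + T) := Nat.mul_le_mul_right _ hk'
      rw [Nat.succ_mul]
      omega

/-! ### Registers and arrays after an update -/

namespace State

@[simp] theorem reg_setReg (s : State) (x v y : ℕ) :
    (s.setReg x v).reg y = if y = x then v else s.reg y := by
  simp [setReg, Function.update_apply]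

@[simp] theorem arr_setReg (s : State) (x v : ℕ) : (s.setReg x v).arr = s.arr := rfl

@[simp] theorem reg_setArr (s : State) (b j v : ℕ) : (s.setArr b j v).reg = s.reg := rfl

@[simp] theorem arr_setArr (s : State) (b j v b' : ℕ) :
    (s.setArr b j v).arr b' = if b' = b then Function.update (s.arr b') j v else s.arr b' := by
  by_cases h : b' = b
  · subst h; simp [setArr]
  · simp [setArr, h]

@[simp] theorem setReg_setReg (s : State) (x v v' : ℕ) :
    (s.setReg x v).setReg x v' = s.setReg x v' := by
  simp [setReg]

theorem setReg_comm (s : State) {x y : ℕ} (h : x ≠ y) (v v' : ℕ) :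
    (s.setReg x v).setReg y v' = (s.setReg y v').setReg x v := by
  simp only [setReg]
  rw [Function.update_comm h]

@[simp] theorem setReg_reg (s : State) (x : ℕ) : s.setReg x (s.reg x) = s := by
  simp [setReg]

end State

end RAM

/-! ### Greedy parsing computes the LZ78 factorization -/

namespace LZ78

variable {α : Type} {fs L : List (List α)} {ids I : List (Id α)} {cur f : List α} {c : α}

theorem mem_dict_iff {i : ℕ} {g : List α} :
    g ∈ dict fs i ↔ (∃ a, g = [a]) ∨ ∃ k < i, g = entry fs k := by
  induction i with
  | zero => simp [dict]
  | succ i ih =>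
    simp only [dict, Set.mem_union, ih, Set.mem_singleton_iff, or_assoc]
    refine or_congr_right ⟨?_, ?_⟩
    · rintro (⟨k, hk, h⟩ | h)
      · exact ⟨k, by omega, h⟩
      · exact ⟨i, by omega, h⟩
    · rintro ⟨k, hk, h⟩
      rcases Nat.lt_succ_iff_lt_or_eq.1 hk with hk | rfl
      · exact .inl ⟨k, hk, h⟩
      · exact .inr h

theorem mem_dict_of_denotes {i : ℕ} {x : Id α} (h : x.Denotes fs i f) : f ∈ dict fs i := by
  rw [mem_dict_iff]
  cases x with
  | letter a => exact .inl ⟨a, h⟩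
  | entry k => exact .inr ⟨k, h⟩

/-- Transfers facts about old dictionaries when the factor list grows, since the entries of finished
factors no longer change. -/
theorem dict_congr {fs' : List (List α)} {i : ℕ} (h : ∀ k < i, entry fs k = entry fs' k) :
    dict fs i = dict fs' i := by
  ext g
  simp only [mem_dict_iff]
  refine or_congr_right (exists_congr fun k => and_congr_right fun hk => ?_)
  rw [h k hk]

theorem denotes_congr {fs' : List (List α)} {i : ℕ} (h : ∀ k < i, entry fs k = entry fs' k)
    {x : Id α} : x.Denotes fs i f ↔ x.Denotes fs' i f := by
  cases x with
  | letter a => rfl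
  | entry k =>
    refine and_congr_right fun hk => ?_
    rw [h k hk]

/-- The state of a greedy parser: `L` are the finished factors, `cur` is the current one, and
`I` and `x` are their IDs. -/
structure Greedy (L : List (List α)) (cur : List α) (I : List (Id α)) (x : Id α) : Prop where
  ne_nil : ∀ f ∈ L ++ [cur], f ≠ []
  encoding : IsEncoding (L ++ [cur]) (I ++ [x])
  notMem : ∀ k < L.length, entry (L ++ [cur]) k ∉ dict (L ++ [cur]) k

theorem Greedy.length_eq {x : Id α} (h : Greedy L cur I x) : I.length = L.length := by
  have := h.encoding.1
  simpa using this

theorem entry_append_of_lt {f : List α} {k : ℕ} (hk : k < L.length) :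
    entry (L ++ [cur] ++ [f]) k = entry (L ++ [cur]) k := by
  unfold entry
  rw [List.getD_append (L ++ [cur]) [f] _ k (by simp; omega),
    List.getD_append (L ++ [cur]) [f] _ (k + 1) (by simp; omega)]

/-- Only the first letter of the following factor enters an entry, and growth at the end of a
nonempty factor leaves that letter alone. -/
theorem entry_append_concat {k : ℕ} (hc : cur ≠ []) (hk : k < L.length) :
    entry (L ++ [cur ++ [c]]) k = entry (L ++ [cur]) k := by
  unfold entry
  rw [List.getD_append _ _ _ _ hk, List.getD_append _ _ _ _ hk]
  rcases Nat.lt_or_ge (k + 1) L.length with h | h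
  · rw [List.getD_append _ _ _ _ h, List.getD_append _ _ _ _ h]
  · have : k + 1 = L.length := by omega
    obtain ⟨a, l, rfl⟩ := List.exists_cons_of_ne_nil hc
    simp [this]

theorem entry_append_last : entry (L ++ [cur] ++ [[c]]) L.length = cur ++ [c] := by
  simp [entry]

/-- The letter that ends the `k`-th entry. -/
theorem Greedy.exists_entry_eq {x : Id α} (h : Greedy L cur I x) {k : ℕ} (hk : k < L.length) :
    ∃ a, ((L ++ [cur]).getD (k + 1) []).take 1 = [a] ∧ entry (L ++ [cur]) k = L[k] ++ [a] := by
  have h1 : k + 1 < (L ++ [cur]).length := by simp; omega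
  have h2 := h.ne_nil _ (List.getElem_mem h1)
  obtain ⟨a, l, hal⟩ := List.exists_cons_of_ne_nil h2
  refine ⟨a, ?_, ?_⟩
  · rw [List.getD_eq_getElem _ _ h1, hal]; rfl
  · rw [entry, List.getD_eq_getElem _ _ h1, hal, List.getD_append _ _ _ _ hk,
      List.getD_eq_getElem _ _ hk]
    rfl

theorem Greedy.denotes_last {x : Id α} (h : Greedy L cur I x) :
    x.Denotes (L ++ [cur]) L.length cur := by
  have := h.encoding.2 L.length (by simp) (by simp [h.length_eq])
  simpa [← h.length_eq] using this

theorem Greedy.denotes {x : Id α} (h : Greedy L cur I x) {k : ℕ} (hk : k < L.length)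
    (hk' : k < I.length) : I[k].Denotes (L ++ [cur]) k L[k] := by
  have := h.encoding.2 k (by simp; omega) (by simp; omega)
  rwa [List.getElem_append_left hk, List.getElem_append_left hk'] at this

theorem Greedy.cur_ne_nil {x : Id α} (h : Greedy L cur I x) : cur ≠ [] :=
  h.ne_nil _ (by simp)

theorem Greedy.getElem_ne_nil {x : Id α} (h : Greedy L cur I x) {k : ℕ} (hk : k < L.length) :
    L[k] ≠ [] :=
  h.ne_nil _ (List.mem_append_left _ (List.getElem_mem hk))

/-- Finished factors are nonempty, so entries have at least two letters. This keeps the IDs of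
letters and of entries apart. -/
theorem Greedy.entry_ne_singleton {x : Id α} (h : Greedy L cur I x) {k : ℕ} (hk : k < L.length)
    (a : α) : entry (L ++ [cur]) k ≠ [a] := by
  obtain ⟨b, -, hb⟩ := h.exists_entry_eq hk
  have := List.length_pos_iff.2 (h.getElem_ne_nil hk)
  intro e
  have := congrArg List.length (hb.symm.trans e)
  simp only [List.length_append, List.length_singleton] at this
  omega

/-- If two entries agreed, the later one would already lie in its own dictionary, against `notMem`.
-/
theorem Greedy.entry_injective {x : Id α} (h : Greedy L cur I x) {k l : ℕ} (hk : k < L.length)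
    (hl : l < L.length) (e : entry (L ++ [cur]) k = entry (L ++ [cur]) l) : k = l := by
  rcases lt_trichotomy k l with hkl | hkl | hkl
  · exact absurd (mem_dict_iff.2 (.inr ⟨k, hkl, e.symm⟩)) (h.notMem l hl)
  · exact hkl
  · exact absurd (mem_dict_iff.2 (.inr ⟨l, hkl, e⟩)) (h.notMem k hk)

/-- A string has at most one ID. -/
theorem Greedy.denotes_unique {x : Id α} (h : Greedy L cur I x) {y z : Id α} {i j : ℕ}
    (hi : i ≤ L.length) (hj : j ≤ L.length) (hy : y.Denotes (L ++ [cur]) i f)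
    (hz : z.Denotes (L ++ [cur]) j f) : y = z := by
  cases y with
  | letter a =>
    cases z with
    | letter b =>
      have : [a] = [b] := hy.symm.trans hz
      simp_all
    | entry l => exact absurd (hz.2.symm.trans hy) (h.entry_ne_singleton (by have := hz.1; omega) a)
  | entry k =>
    cases z with
    | letter b =>
      exact absurd (hy.2.symm.trans hz) (h.entry_ne_singleton (by have := hy.1; omega) b)
    | entry l =>
      rw [h.entry_injective (by have := hy.1; omega) (by have := hz.1; omega)
        (hy.2.symm.trans hz.2)]

/-- The entries that extend the current factor by `c` are the children of its ID with the
letter `c`. -/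
theorem Greedy.entry_eq_iff {x : Id α} (h : Greedy L cur I x) {k : ℕ} (hk : k < L.length) :
    entry (L ++ [cur]) k = cur ++ [c] ↔
      I[k]? = some x ∧ ((L ++ [cur]).getD (k + 1) []).take 1 = [c] := by
  obtain ⟨a, ha, he⟩ := h.exists_entry_eq hk
  have hk' : k < I.length := h.length_eq ▸ hk
  rw [he, ha, List.getElem?_eq_getElem hk', Option.some_inj]
  constructor
  -- Cancelling the last letter leaves equal strings; uniqueness of IDs turns this into equality of
  -- IDs, which is what the trie stores.
  · intro e
    obtain ⟨e₁, e₂⟩ := List.append_inj' e rfl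
    refine ⟨h.denotes_unique hk.le le_rfl (h.denotes hk hk') ?_, e₂⟩
    rw [e₁]
    exact h.denotes_last
  · rintro ⟨e₁, e₂⟩
    have h₁ := h.denotes hk hk'
    have h₂ := h.denotes_last
    rw [e₁] at h₁
    rw [e₂]
    congr 1
    cases x with
    | letter b => exact h₁.trans h₂.symm
    | entry l => exact h₁.2.trans h₂.2.symm

theorem Greedy.concat_mem_dict_iff {x : Id α} (h : Greedy L cur I x) :
    cur ++ [c] ∈ dict (L ++ [cur]) L.length ↔
      ∃ k < L.length, entry (L ++ [cur]) k = cur ++ [c] := by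
  rw [mem_dict_iff]
  refine ⟨?_, fun ⟨k, hk, e⟩ => .inr ⟨k, hk, e.symm⟩⟩
  rintro (⟨a, e⟩ | ⟨k, hk, e⟩)
  · have := List.length_pos_iff.2 h.cur_ne_nil
    have := congrArg List.length e
    simp only [List.length_append, List.length_singleton] at this
    omega
  · exact ⟨k, hk, e.symm⟩

/-! ### Moves of the greedy parser and their correctness -/

theorem greedy_singleton (c : α) : Greedy [] [c] [] (.letter c) where
  ne_nil := by simp
  encoding := by
    refine ⟨rfl, fun i hi hi' => ?_⟩
    obtain rfl : i = 0 := by simpa using hi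
    rfl
  notMem := by simp

/-- Extending the current factor. -/
theorem Greedy.extend {x : Id α} (h : Greedy L cur I x) {k : ℕ} (hk : k < L.length)
    (e : entry (L ++ [cur]) k = cur ++ [c]) : Greedy L (cur ++ [c]) I (.entry k) where
  ne_nil f hf := by
    rcases List.mem_append.1 hf with hf | hf
    · exact h.ne_nil f (List.mem_append_left _ hf)
    · obtain rfl : f = cur ++ [c] := by simpa using hf
      simp
  encoding := by
    refine ⟨by simp [h.length_eq], fun i hi hi' => ?_⟩
    rcases Nat.lt_or_ge i L.length with hi₁ | hi₁
    · have hi₂ : i < I.length := h.length_eq ▸ hi₁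
      rw [List.getElem_append_left hi₁, List.getElem_append_left hi₂]
      refine (denotes_congr fun l hl => ?_).2 (h.denotes hi₁ hi₂)
      exact entry_append_concat h.cur_ne_nil (by omega)
    · obtain rfl : i = L.length := by simp at hi; omega
      have : (I ++ [Id.entry k])[L.length] = Id.entry k := by simp [← h.length_eq]
      rw [this]
      refine ⟨hk, ?_⟩
      rw [entry_append_concat h.cur_ne_nil hk, e]
      simp
  notMem k hk := by
    rw [entry_append_concat h.cur_ne_nil hk,
      dict_congr fun l hl => entry_append_concat h.cur_ne_nil (by omega)]
    exact h.notMem k hk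

/-- Starting a new factor. -/
theorem Greedy.next {x : Id α} (h : Greedy L cur I x)
    (e : cur ++ [c] ∉ dict (L ++ [cur]) L.length) :
    Greedy (L ++ [cur]) [c] (I ++ [x]) (.letter c) where
  ne_nil f hf := by
    rcases List.mem_append.1 hf with hf | hf
    · exact h.ne_nil f hf
    · obtain rfl : f = [c] := by simpa using hf
      simp
  encoding := by
    refine ⟨by simp [h.length_eq], fun i hi hi' => ?_⟩
    rcases Nat.lt_or_ge i (L ++ [cur]).length with hi₁ | hi₁
    · have hi₂ : i < (I ++ [x]).length := by simpa [h.length_eq] using hi₁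
      rw [List.getElem_append_left hi₁, List.getElem_append_left hi₂]
      refine (denotes_congr fun l hl => ?_).2 (h.encoding.2 i hi₁ hi₂)
      exact entry_append_of_lt (by simp at hi₁; omega)
    · obtain rfl : i = (L ++ [cur]).length := by simp at hi hi₁ ⊢; omega
      have : (I ++ [x] ++ [Id.letter c])[(L ++ [cur]).length] = Id.letter c := by
        simp [← h.length_eq]
      rw [this]
      show (L ++ [cur] ++ [[c]])[(L ++ [cur]).length] = [c]
      simp
  notMem k hk := by
    rcases Nat.lt_or_ge k L.length with hk₁ | hk₁
    · rw [entry_append_of_lt hk₁, dict_congr fun l hl => entry_append_of_lt (by omega)]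
      exact h.notMem k hk₁
    -- The only new entry is `cur ++ [c]`, and its novelty is the hypothesis `e`.
    · obtain rfl : k = L.length := by simp at hk; omega
      rw [entry_append_last, dict_congr fun l hl => entry_append_of_lt hl]
      exact e

/-- A proper prefix of an entry is a prefix of the factor `L[k]`, which lies in the smaller
dictionary `k`; induction on `i` finishes. -/
theorem Greedy.prefix_mem_dict {x : Id α} (h : Greedy L cur I x) {i : ℕ} (hi : i ≤ L.length)
    {g g' : List α} (hg : g ∈ dict (L ++ [cur]) i) (hp : g' <+: g) (hne : g' ≠ []) :
    g' ∈ dict (L ++ [cur]) i := by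
  induction i using Nat.strong_induction_on generalizing g with
  | _ i ih =>
    rcases mem_dict_iff.1 hg with ⟨a, rfl⟩ | ⟨k, hk, rfl⟩
    · rcases List.prefix_cons_iff.1 hp with rfl | ⟨t, rfl, ht⟩
      · exact absurd rfl hne
      · rw [List.prefix_nil.1 ht]
        exact mem_dict_iff.2 (.inl ⟨a, rfl⟩)
    · obtain ⟨a, -, he⟩ := h.exists_entry_eq (show k < L.length by omega)
      rw [he] at hp
      rcases List.prefix_concat_iff.1 hp with rfl | hp
      · rwa [← he]
      · have hk' : k < I.length := by have := h.length_eq; omega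
        have := ih k hk (by omega) (mem_dict_of_denotes (h.denotes (by omega) hk')) hp
        rcases mem_dict_iff.1 this with h' | ⟨l, hl, h'⟩
        · exact mem_dict_iff.2 (.inl h')
        · exact mem_dict_iff.2 (.inr ⟨l, by omega, h'⟩)

theorem Greedy.isFactorization {x : Id α} (h : Greedy L cur I x) :
    IsFactorization (L ++ [cur]).flatten (L ++ [cur]) := by
  refine ⟨rfl, fun i hi => ⟨?_, fun g hg hp => ?_⟩⟩
  · exact mem_dict_of_denotes (h.encoding.2 i hi (by have := h.length_eq; simp at hi ⊢; omega))
  · rcases Nat.lt_or_ge i L.length with hi₁ | hi₁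
    -- A longer match `g` and the `i`-th entry are both prefixes of the remaining text, and the
    -- entry is only one letter longer than the factor. So the entry is a prefix of `g` and lies in
    -- the dictionary, against `notMem`.
    · by_contra! hlt
      rw [List.getElem_append_left hi₁] at hlt
      obtain ⟨a, ha, he⟩ := h.exists_entry_eq hi₁
      refine h.notMem i hi₁ (h.prefix_mem_dict hi₁.le hg ?_ (by simp [he]))
      refine List.prefix_of_prefix_length_le (l₃ := ((L ++ [cur]).drop i).flatten) ?_ hp
        (by rw [he]; simpa using hlt)
      have h1 : i + 1 < (L ++ [cur]).length := by simp; omega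
      rw [List.drop_eq_getElem_cons hi, List.drop_eq_getElem_cons h1, List.flatten_cons,
        List.flatten_cons, he, List.getElem_append_left hi₁]
      refine (List.prefix_append_right_inj _).2 ?_
      rw [List.getD_eq_getElem _ _ h1] at ha
      rw [← ha]
      exact (List.take_prefix _ _).trans (List.prefix_append _ _)
    -- The last factor is all that remains of the text, so no prefix is longer.
    · obtain rfl : i = L.length := by simp at hi; omega
      simpa using hp.length_le

/-- An entry `k < i` is one letter longer than the factor `k`, so lengths grow by at most one per
index. -/
theorem Greedy.length_getElem_le {x : Id α} (h : Greedy L cur I x) {i : ℕ}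
    (hi : i < (L ++ [cur]).length) : (L ++ [cur])[i].length ≤ i + 1 := by
  induction i using Nat.strong_induction_on with
  | _ i ih =>
    have := mem_dict_of_denotes
      (h.encoding.2 i hi (by have := h.length_eq; simp at hi ⊢; omega))
    rcases mem_dict_iff.1 this with ⟨a, e⟩ | ⟨k, hk, e⟩
    · simp [e]
    · have hk' : k < L.length := by simp at hi; omega
      obtain ⟨a, -, he⟩ := h.exists_entry_eq hk'
      have := ih k hk (by omega)
      rw [List.getElem_append_left hk'] at this
      rw [e, he]
      simp
      omega

/-- The text is at most quadratically longer than its factorization. -/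
theorem Greedy.length_flatten_le {x : Id α} (h : Greedy L cur I x) :
    (L ++ [cur]).flatten.length ≤ (L ++ [cur]).length ^ 2 := by
  rw [List.length_flatten, sq]
  refine (List.sum_le_card_nsmul _ (L ++ [cur]).length ?_).trans (by simp)
  intro l hl
  obtain ⟨f, hf, rfl⟩ := List.mem_map.1 hl
  obtain ⟨i, hi, rfl⟩ := List.getElem_of_mem hf
  exact (h.length_getElem_le hi).trans hi

/-- Factors are nonempty. This keeps the factor counter and the pointers below the word bound. -/
theorem Greedy.length_le_length_flatten {α : Type} {L : List (List α)} {cur : List α}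
    {I : List (Id α)} {x : Id α} (h : Greedy L cur I x) :
    (L ++ [cur]).length ≤ (L ++ [cur]).flatten.length := by
  rw [List.length_flatten, ← List.length_map (f := List.length) (as := L ++ [cur])]
  refine List.length_le_sum_of_one_le _ fun l hl => ?_
  obtain ⟨f, hf, rfl⟩ := List.mem_map.1 hl
  exact List.length_pos_iff.2 (h.ne_nil f hf)

/-! ### The children of a node -/

open Classical in
/-- The entries whose parent has the ID `u`, latest first, where `I` holds the IDs of the
parents. -/
noncomputable def children (I : List (Id α)) (u : Id α) : List ℕ :=
  ((List.range I.length).filter (fun k => I[k]? = some u)).reverse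

theorem mem_children {u : Id α} {k : ℕ} : k ∈ children I u ↔ I[k]? = some u := by
  simp only [children, List.mem_reverse, List.mem_filter, List.mem_range, decide_eq_true_eq,
    and_iff_right_iff_imp]
  intro h
  exact (List.getElem?_eq_some_iff.1 h).1

theorem nodup_children (I : List (Id α)) (u : Id α) : (children I u).Nodup :=
  List.nodup_reverse.2 (List.nodup_range.filter _)

-- Latest-first order makes a new entry the head of its list, so insertion takes constant time.
open Classical in
theorem children_concat_self (x : Id α) : children (I ++ [x]) x = I.length :: children I x := by
  simp only [children, List.length_append, List.length_singleton, List.range_succ,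
    List.filter_append, List.reverse_append]
  rw [List.filter_congr (l := List.range I.length) (q := fun k => decide (I[k]? = some x))]
  · simp
  · intro k hk
    rw [List.getElem?_append_left (List.mem_range.1 hk)]

open Classical in
theorem children_concat_of_ne {x u : Id α} (h : x ≠ u) :
    children (I ++ [x]) u = children I u := by
  simp only [children, List.length_append, List.length_singleton, List.range_succ,
    List.filter_append, List.reverse_append]
  rw [List.filter_congr (l := List.range I.length) (q := fun k => decide (I[k]? = some u))]
  · simp [h]
  · intro k hk
    rw [List.getElem?_append_left (List.mem_range.1 hk)]

/-- Siblings end in different letters, so that there are at most as many of them as there are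
letters in the text. -/
theorem Greedy.length_children_le {x : Id α} (h : Greedy L cur I x) [DecidableEq α]
    {A : Finset α} (hA : ∀ a ∈ (L ++ [cur]).flatten, a ∈ A) : (children I x).length ≤ A.card := by
  have key : ∀ k ∈ children I x, ∃ a ∈ A, entry (L ++ [cur]) k = cur ++ [a] ∧ k < L.length := by
    intro k hk
    have hk₁ := mem_children.1 hk
    have hk₂ : k < L.length := h.length_eq ▸ (List.getElem?_eq_some_iff.1 hk₁).1
    obtain ⟨a, ha, -⟩ := h.exists_entry_eq hk₂
    refine ⟨a, hA a ?_, (h.entry_eq_iff hk₂).2 ⟨hk₁, ha⟩, hk₂⟩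
    have h1 : k + 1 < (L ++ [cur]).length := by simp; omega
    rw [List.getD_eq_getElem _ _ h1] at ha
    refine List.mem_flatten.2 ⟨_, List.getElem_mem h1, List.mem_of_mem_take (i := 1) ?_⟩
    rw [ha]
    simp
  have : Nonempty α := ⟨cur.head h.cur_ne_nil⟩
  choose! g hg using key
  rw [← List.toFinset_card_of_nodup (nodup_children I x)]
  -- A sibling is sent to its last letter; equal letters give equal entries `cur ++ [a]`, hence
  -- equal numbers.
  refine Finset.card_le_card_of_injOn g (fun k hk => (hg k (List.mem_toFinset.1 hk)).1) ?_
  intro k hk l hl e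
  have h₁ := hg k (List.mem_toFinset.1 hk)
  have h₂ := hg l (List.mem_toFinset.1 hl)
  exact h.entry_injective h₁.2.2 h₂.2.2 (by rw [h₁.2.1, h₂.2.1, e])

end LZ78

/-! ### Facts about straight line programs -/

namespace SLP

variable {α : Type} {σ : ℕ}

theorem val_of_letter {G : SLP α} {i : ℕ} {hi : i < G.size} {a : α}
    (h : G.rule ⟨i, hi⟩ = .letter a) : G.val i hi = [a] := by
  rw [val, h]

theorem val_of_pair {G : SLP α} {i : ℕ} {hi : i < G.size} {l r : Fin i}
    (h : G.rule ⟨i, hi⟩ = .pair l r) :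
    G.val i hi = G.val l (l.isLt.trans hi) ++ G.val r (r.isLt.trans hi) := by
  rw [val, h]

theorem val_ne_nil (G : SLP α) (i : ℕ) (hi : i < G.size) : G.val i hi ≠ [] := by
  induction i using Nat.strong_induction_on with
  | _ i ih =>
    cases h : G.rule ⟨i, hi⟩ with
    | letter a => simp [val_of_letter h]
    | pair l r => simp [val_of_pair h, ih l l.isLt]

theorem str_length_pos (G : SLP α) : 0 < G.str.length :=
  List.length_pos_iff.2 (G.val_ne_nil _ _)

/-- The letters that occur in the rules. -/
def letters [DecidableEq α] (G : SLP α) : Finset α :=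
  Finset.univ.biUnion fun i => match G.rule i with
    | .letter a => {a}
    | .pair _ _ => ∅

/-- Each rule contributes at most one letter. This bounds the branching of the trie by `n` instead
of the alphabet size. -/
theorem card_letters_le [DecidableEq α] (G : SLP α) : G.letters.card ≤ G.size := by
  refine (Finset.card_biUnion_le_card_mul _ _ 1 fun i _ => ?_).trans (by simp)
  split <;> simp

theorem mem_letters_of_mem_val [DecidableEq α] (G : SLP α) (i : ℕ) (hi : i < G.size) {a : α}
    (ha : a ∈ G.val i hi) : a ∈ G.letters := by
  induction i using Nat.strong_induction_on with
  | _ i ih =>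
    cases h : G.rule ⟨i, hi⟩ with
    | letter b =>
      rw [val_of_letter h, List.mem_singleton] at ha
      subst ha
      refine Finset.mem_biUnion.2 ⟨⟨i, hi⟩, Finset.mem_univ _, ?_⟩
      rw [h]
      simp
    | pair l r =>
      rw [val_of_pair h, List.mem_append] at ha
      exact ha.elim (ih l l.isLt _) (ih r r.isLt _)

theorem initState_of_letter {G : SLP (Fin σ)} {i : ℕ} {hi : i < G.size} {a : Fin σ}
    (h : G.rule ⟨i, hi⟩ = .letter a) : G.initState.arr 0 i = 0 ∧ G.initState.arr 1 i = a := by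
  simp [initState, hi, h, Expr.word]

theorem initState_of_pair {G : SLP (Fin σ)} {i : ℕ} {hi : i < G.size} {l r : Fin i}
    (h : G.rule ⟨i, hi⟩ = .pair l r) :
    G.initState.arr 0 i = 1 ∧ G.initState.arr 1 i = l ∧ G.initState.arr 2 i = r := by
  simp [initState, hi, h, Expr.word]

end SLP

/-! ### The program

Registers: `0` size of the input, `1` number of factors, `2` position in the text, `3` length of
the text, `4` cursor in a list of children, `5` loop counter, `10` and `11` variable and offset
during a descent in the grammar, `12` letter that was read.

Arrays: `5` lengths of the values of the variables, `6` and `7` heads of the lists of children of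
letters and entries, `8` next sibling of an entry, `9` last letter of an entry. The pointer to the
entry `k` is `k + 1`, and `0` is the null pointer. -/

namespace RAM

/-- Computes the lengths of the values of all variables, modulo `W`. -/
def computeLengths : Cmd :=
  .while (.op .lt (.reg 5) (.reg 0)) <|
    .seq
      (.ite (.read 0 (.reg 5))
        (.write 5 (.reg 5)
          (.op .add (.read 5 (.read 1 (.reg 5))) (.read 5 (.read 2 (.reg 5)))))
        (.write 5 (.reg 5) (.const 1)))
      (.assign 5 (.op .add (.reg 5) (.const 1)))

/-- Replaces a variable that is not a letter by the factor that contains the offset. -/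
def descend : Cmd :=
  .ite (.op .lt (.reg 11) (.read 5 (.read 1 (.reg 10))))
    (.assign 10 (.read 1 (.reg 10)))
    (.seq (.assign 11 (.op .sub (.reg 11) (.read 5 (.read 1 (.reg 10)))))
      (.assign 10 (.read 2 (.reg 10))))

/-- Reads the letter of the text at the current position. -/
def readLetter : Cmd :=
  .seq (.assign 10 (.op .sub (.reg 0) (.const 1))) <|
  .seq (.assign 11 (.reg 2)) <|
  .seq (.while (.read 0 (.reg 10)) descend) <|
  .assign 12 (.read 1 (.reg 10))

/-- Searches a list of children for the letter that was read. -/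
def searchChild : Cmd :=
  -- For truth values, `a < b` means "not `a`, and `b`": the pointer is not null and the letter
  -- differs. At the null pointer truncated subtraction reads cell `0`, whose content is then
  -- irrelevant.
  .while (.op .lt (.op .eq (.read 9 (.op .sub (.reg 4) (.const 1))) (.reg 12))
      (.op .lt (.const 0) (.reg 4)))
    (.assign 4 (.read 8 (.op .sub (.reg 4) (.const 1))))

/-- Moves the current factor to the child that was found. -/
def extendFactor : Cmd :=
  .seq (.write 3 (.op .sub (.reg 1) (.const 1)) (.const 1)) <|
  .seq (.write 4 (.op .sub (.reg 1) (.const 1)) (.op .sub (.reg 4) (.const 1))) <|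
  .assign 4 (.read 7 (.op .sub (.reg 4) (.const 1)))

/-- Prepends the new entry to the list of children of the current factor, where `b` is the array
of the heads. -/
def pushChild (b : ℕ) : Cmd :=
  -- The new entry has number `reg 1 - 1`, so the pointer to it is `reg 1` itself.
  .seq (.write 8 (.op .sub (.reg 1) (.const 1)) (.read b (.read 4 (.op .sub (.reg 1) (.const 1)))))
    (.write b (.read 4 (.op .sub (.reg 1) (.const 1))) (.reg 1))

/-- Starts a new factor with the letter that was read. -/
def startFactor : Cmd :=
  .seq (.write 3 (.reg 1) (.const 0)) <|
  .seq (.write 4 (.reg 1) (.reg 12)) <|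
  .seq (.assign 4 (.read 6 (.reg 12))) <|
  .assign 1 (.op .add (.reg 1) (.const 1))

/-- Adds the new entry to the dictionary and starts a new factor. -/
def nextFactor : Cmd :=
  .seq (.write 9 (.op .sub (.reg 1) (.const 1)) (.reg 12)) <|
  .seq (.ite (.read 3 (.op .sub (.reg 1) (.const 1))) (pushChild 7) (pushChild 6)) startFactor

/-- Processes one letter of the text. -/
def processLetter : Cmd :=
  .seq readLetter <|
  .seq searchChild <|
  .seq (.ite (.reg 4) extendFactor nextFactor) <|
  .assign 2 (.op .add (.reg 2) (.const 1))

/-- Computes the LZ78 factorization of the text that is represented by a straight line program. -/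
def lz78 : Cmd :=
  .seq computeLengths <|
  .seq (.assign 3 (.read 5 (.op .sub (.reg 0) (.const 1)))) <|
  -- The first letter is handled before the loop, because a parser state needs a nonempty current
  -- factor.
  .seq readLetter <|
  .seq startFactor <|
  .seq (.assign 2 (.const 1)) <|
  .while (.op .lt (.reg 2) (.reg 3)) processLetter

/-! ### Random access to the text -/

variable {σ W : ℕ} {G : SLP (Fin σ)}

theorem ite_mod (hW : 1 < W) (p : Prop) [Decidable p] :
    (if p then 1 else 0) % W = if p then 1 else 0 := by
  split
  · exact Nat.mod_eq_of_lt hW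
  · exact Nat.zero_mod _

/-- The state holds the grammar and the lengths of the values of its variables. -/
structure State.HasGrammar (W : ℕ) (G : SLP (Fin σ)) (s : State) : Prop where
  size : s.reg 0 = G.size
  rules : ∀ b < 3, s.arr b = G.initState.arr b
  lengths : ∀ i (hi : i < G.size), s.arr 5 i = (G.val i hi).length % W

theorem State.HasGrammar.congr {s s' : State} (h : s.HasGrammar W G) (h₀ : s'.reg 0 = s.reg 0)
    (h₁ : ∀ b < 3, s'.arr b = s.arr b) (h₅ : s'.arr 5 = s.arr 5) : s'.HasGrammar W G :=
  ⟨h₀.trans h.size, fun b hb => (h₁ b hb).trans (h.rules b hb), h₅ ▸ h.lengths⟩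

theorem runs_computeLengths (hn : G.size < W) :
    Runs W computeLengths G.initState (40 * G.size) fun s =>
      s.HasGrammar W G ∧ (∀ x ≠ 5, s.reg x = G.initState.reg x) ∧
        ∀ b ≠ 5, s.arr b = G.initState.arr b := by
  have hp := G.size_pos
  have hW : 1 < W := by omega
  have := Runs.while (W := W) (e := .op .lt (.reg 5) (.reg 0))
    (c := .seq
      (.ite (.read 0 (.reg 5))
        (.write 5 (.reg 5)
          (.op .add (.read 5 (.read 1 (.reg 5))) (.read 5 (.read 2 (.reg 5)))))
        (.write 5 (.reg 5) (.const 1)))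
      (.assign 5 (.op .add (.reg 5) (.const 1)))) (T := 16)
    (I := fun k s => k = G.size - s.reg 5 ∧ s.reg 5 ≤ G.size ∧
      (∀ i (hi : i < G.size), i < s.reg 5 → s.arr 5 i = (G.val i hi).length % W) ∧
      (∀ x ≠ 5, s.reg x = G.initState.reg x) ∧ ∀ b ≠ 5, s.arr b = G.initState.arr b)
    ?_ (G.size) G.initState ?_
  · refine this.mono ?_ ?_
    -- The loop costs at most `20 * (n + 1)`, and `n ≥ 1`.
    · simp only [Expr.cost]; omega
    · rintro s ⟨he, k, hk, h₁, h₂, h₃, h₄⟩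
      have h0 : s.reg 0 = G.size := h₃ 0 (by decide)
      simp only [Expr.eval, Op.eval, ite_mod hW, h0] at he
      have : s.reg 5 = G.size := by
        by_contra hne
        rw [if_pos (by omega)] at he
        omega
      exact ⟨⟨h0, fun b hb => h₄ b (by omega), fun i hi => h₂ i hi (this ▸ hi)⟩, h₃, h₄⟩
  · rintro k s ⟨hk, h₁, h₂, h₃, h₄⟩ he
    have h0 : s.reg 0 = G.size := h₃ 0 (by decide)
    simp only [Expr.eval, Op.eval, ite_mod hW, h0, ne_eq, ite_eq_right_iff, one_ne_zero,
      imp_false, not_not] at he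
    have a0 := h₄ 0 (by decide)
    have a1 := h₄ 1 (by decide)
    have a2 := h₄ 2 (by decide)
    have hmod : (s.reg 5 + 1) % W = s.reg 5 + 1 := Nat.mod_eq_of_lt (by omega)
    refine Runs.seq (T₁ := 12) (T₂ := 4)
      (Q' := fun s' => s' = s.setArr 5 (s.reg 5) ((G.val (s.reg 5) he).length % W)) ?_ ?_ (by decide)
    · cases h : G.rule ⟨s.reg 5, he⟩ with
      | letter a =>
        obtain ⟨e0, -⟩ := SLP.initState_of_letter h
        refine Runs.ite (T' := 9) (fun h' => ?_) (fun _ => ?_) (by decide)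
        · simp [Expr.eval, a0, e0] at h'
        · refine Runs.write (by decide) ?_
          simp [Expr.eval, SLP.val_of_letter h]
      | pair l r =>
        obtain ⟨e0, e1, e2⟩ := SLP.initState_of_pair h
        refine Runs.ite (T' := 9) (fun _ => ?_) (fun h' => ?_) (by decide)
        · refine Runs.write (by decide) ?_
          simp only [Expr.eval, Op.eval, a1, a2, e1, e2, SLP.val_of_pair h, List.length_append]
          rw [h₂ l _ l.isLt, h₂ r _ r.isLt, ← Nat.add_mod]
        · simp [Expr.eval, a0, e0] at h'
    · rintro s' rfl
      refine Runs.assign (by decide) ?_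
      refine ⟨G.size - (s.reg 5 + 1), by omega, ?_⟩
      have e5 : (Expr.op .add (.reg 5) (.const 1)).eval W
          (s.setArr 5 (s.reg 5) ((G.val (s.reg 5) he).length % W)) = s.reg 5 + 1 := by
        simp [Expr.eval, Op.eval, hmod]
      rw [e5]
      refine ⟨by simp, by simpa using he, ?_, ?_, ?_⟩
      · intro i hi hlt
        simp only [State.reg_setReg, if_true] at hlt
        by_cases hi' : i = s.reg 5
        · subst hi'; simp
        · simpa [Function.update_of_ne hi'] using h₂ i hi (by omega)
      · intro x hx
        simpa [hx] using h₃ x hx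
      · intro b hb
        simpa [hb] using h₄ b hb
  · exact ⟨by simp [SLP.initState], by simp [SLP.initState],
      by simp [SLP.initState], fun _ _ => rfl, fun _ _ => rfl⟩

/-- The variable index drops at every step and serves as the iteration bound. Variables off the
descent may have values too long for a word, but those met derive substrings of the text, so their
stored residues are true lengths. -/
theorem runs_readLetter (hn : G.size < W) (hN : G.str.length < W) {s : State}
    (hs : s.HasGrammar W G) {a : Fin σ} (ha : G.str[s.reg 2]? = some a) :
    Runs W readLetter s (40 * G.size) fun s' =>
      ∃ v q, s' = ((s.setReg 10 v).setReg 11 q).setReg 12 a := by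
  have hp := G.size_pos
  have hW : 1 < W := by omega
  have e10 : (Expr.op .sub (.reg 0) (.const 1)).eval W s = G.size - 1 := by
    simp only [Expr.eval, Op.eval, hs.size, Nat.mod_eq_of_lt hW]
    exact Nat.mod_eq_of_lt (by omega)
  refine Runs.assign_seq (T' := 26 * G.size + 5) ?_ (by simp only [Expr.cost]; omega)
  refine Runs.assign_seq (T' := 26 * G.size + 3) ?_ (by simp only [Expr.cost]; omega)
  rw [e10]
  refine Runs.seq (Runs.while (T := 17) (I := fun k s' => ∃ v q, k = v ∧
      s' = (s.setReg 10 v).setReg 11 q ∧ ∃ hv : v < G.size, (G.val v hv).length < W ∧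
      (G.val v hv)[q]? = some a) ?_ (G.size - 1) _ ?_) (T₂ := 3) ?_ ?_
  · rintro k _ ⟨v, q, rfl, rfl, hv, hl, hq⟩ he
    cases h : G.rule ⟨k, hv⟩ with
    | letter b =>
      obtain ⟨e0, -⟩ := SLP.initState_of_letter h
      simp [Expr.eval, hs.rules, e0] at he
    | pair l r =>
      obtain ⟨e0, e1, e2⟩ := SLP.initState_of_pair h
      rw [SLP.val_of_pair h] at hl hq
      rw [List.length_append] at hl
      have hlen : s.arr 5 l = (G.val l (l.isLt.trans hv)).length := by
        rw [hs.lengths l (l.isLt.trans hv), Nat.mod_eq_of_lt (by omega)]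
      have hqlt : q < W := by
        have := (List.getElem?_eq_some_iff.1 hq).1
        rw [List.length_append] at this
        omega
      refine Runs.ite (T' := 10) (fun h' => ?_) (fun h' => ?_) (by decide)
      · simp [Expr.eval, Op.eval, hs.rules, e1, hlen, ite_mod hW] at h'
        refine Runs.assign (by decide) ⟨l, l.isLt, l, q, rfl, ?_, l.isLt.trans hv, by omega, ?_⟩
        · simp [Expr.eval, hs.rules, e1, State.setReg_comm _ (show 11 ≠ 10 by decide)]
        · rwa [List.getElem?_append_left h'] at hq
      · simp [Expr.eval, Op.eval, hs.rules, e1, hlen, ite_mod hW] at h'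
        refine Runs.assign_seq (T' := 3) (Runs.assign (by decide) ?_) (by decide)
        refine ⟨r, r.isLt, r, q - (G.val l (l.isLt.trans hv)).length, rfl, ?_,
          r.isLt.trans hv, by omega, ?_⟩
        · have : (q - (G.val l (l.isLt.trans hv)).length) % W =
              q - (G.val l (l.isLt.trans hv)).length := Nat.mod_eq_of_lt (by omega)
          simp [Expr.eval, Op.eval, hs.rules, e1, e2, hlen, this,
            State.setReg_comm _ (show 11 ≠ 10 by decide)]
        · rwa [List.getElem?_append_right h'] at hq
  · exact ⟨_, _, rfl, rfl, by omega, hN, by simpa [Expr.eval, SLP.str] using ha⟩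
  · rintro _ ⟨he, k, v, q, rfl, rfl, hv, hl, hq⟩
    cases h : G.rule ⟨k, hv⟩ with
    | letter b =>
      obtain ⟨-, e1⟩ := SLP.initState_of_letter h
      refine Runs.assign (by decide) ⟨k, q, ?_⟩
      rw [SLP.val_of_letter h] at hq
      obtain rfl : b = a := by
        cases q with
        | zero => simpa using hq
        | succ q => simp at hq
      simp [Expr.eval, hs.rules, e1]
    | pair l r =>
      obtain ⟨e0, -⟩ := SLP.initState_of_pair h
      simp [Expr.eval, hs.rules, e0] at he
  · simp only [Expr.cost]
    omega

open LZ78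

/-! ### Lists of children -/

/-- The pointer `h` leads to a linked list with the entries `l`. -/
def Linked (next : ℕ → ℕ) : ℕ → List ℕ → Prop
  | h, [] => h = 0
  | h, k :: l => h = k + 1 ∧ Linked next (next k) l

theorem Linked.congr {next next' : ℕ → ℕ} {l : List ℕ} (hl : ∀ k ∈ l, next' k = next k) {h : ℕ}
    (H : Linked next h l) : Linked next' h l := by
  induction l generalizing h with
  | nil => exact H
  | cons k l ih =>
    refine ⟨H.1, ?_⟩
    rw [hl k (by simp)]
    exact ih (fun k hk => hl k (by simp [hk])) H.2

/-- The head of the list of children of a node. -/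
def State.head (s : State) : LZ78.Id (Fin σ) → ℕ
  | .letter a => s.arr 6 a
  | .entry k => s.arr 7 k

/-- The state represents the state `L, cur, I, x` of a greedy parser. -/
structure State.Represents (s : State) (L : List (List (Fin σ))) (cur : List (Fin σ))
    (I : List (LZ78.Id (Fin σ))) (x : LZ78.Id (Fin σ)) : Prop where
  outputs : s.Outputs (I ++ [x])
  letters : ∀ k < L.length, ∀ a, ((L ++ [cur]).getD (k + 1) []).take 1 = [a] → s.arr 9 k = a
  linked : ∀ u, Linked (s.arr 8) (s.head u) (children I u)
  cursor : s.reg 4 = s.head x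

theorem runs_searchChild {s : State} {L : List (List (Fin σ))} {cur : List (Fin σ)}
    {I : List (LZ78.Id (Fin σ))} {x : LZ78.Id (Fin σ)} {c : Fin σ} (hW : 1 < W) (hL : L.length < W)
    (hg : Greedy L cur I x) (hs : s.Represents L cur I x) (hc : s.reg 12 = c) :
    Runs W searchChild s (20 * ((children I x).length + 1)) fun s' =>
      (s' = s.setReg 4 0 ∧ cur ++ [c] ∉ dict (L ++ [cur]) L.length) ∨
        ∃ k < L.length, s' = s.setReg 4 (k + 1) ∧ entry (L ++ [cur]) k = cur ++ [c] := by
  have hlt : ∀ k ∈ children I x, k < L.length := fun k hk =>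
    hg.length_eq ▸ (List.getElem?_eq_some_iff.1 (mem_children.1 hk)).1
  have hletter : ∀ k ∈ children I x, (s.arr 9 k = c ↔ entry (L ++ [cur]) k = cur ++ [c]) := by
    intro k hk
    obtain ⟨a, ha, -⟩ := hg.exists_entry_eq (hlt k hk)
    rw [hg.entry_eq_iff (hlt k hk), hs.letters k (hlt k hk) a ha, ha]
    simp [mem_children.1 hk, Fin.val_inj]
  have hcond : ∀ k < L.length,
      (Expr.op .lt (.op .eq (.read 9 (.op .sub (.reg 4) (.const 1))) (.reg 12))
        (.op .lt (.const 0) (.reg 4))).eval W (s.setReg 4 (k + 1)) =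
        if s.arr 9 k = c then 0 else 1 := by
    intro k hk
    have : k % W = k := Nat.mod_eq_of_lt (by omega)
    by_cases h : s.arr 9 k = c <;>
      simp [Expr.eval, Op.eval, Nat.mod_eq_of_lt hW, this, hc, h]
  -- The rest of the list consists of children and still contains every child with the wanted
  -- letter, so reaching its end proves absence.
  refine (Runs.while (T := 6) (I := fun n s' => ∃ h l, n = l.length ∧ s' = s.setReg 4 h ∧
    Linked (s.arr 8) h l ∧ (∀ k ∈ l, k ∈ children I x) ∧
    ∀ k ∈ children I x, s.arr 9 k = c → k ∈ l) ?_ (children I x).length s ?_).mono ?_ ?_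
  · rintro n _ ⟨h, l, rfl, rfl, hl, h₁, h₂⟩ he
    cases l with
    | nil =>
      obtain rfl : h = 0 := hl
      simp [Expr.eval, Op.eval, ite_mod hW, Nat.mod_eq_of_lt hW] at he
    | cons k l =>
      obtain ⟨rfl, hl⟩ := hl
      have hk := hlt k (h₁ k (by simp))
      rw [hcond k hk] at he
      refine Runs.assign (by decide) ⟨l.length, by simp, s.arr 8 k, l, rfl, ?_, hl, ?_, ?_⟩
      · have : k % W = k := Nat.mod_eq_of_lt (by omega)
        simp [Expr.eval, Op.eval, Nat.mod_eq_of_lt hW, this]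
      · exact fun k hk => h₁ k (by simp [hk])
      · intro k' hk' e
        rcases List.mem_cons.1 (h₂ k' hk' e) with rfl | h
        · simp [e] at he
        · exact h
  · exact ⟨s.reg 4, children I x, rfl, by simp, hs.cursor ▸ hs.linked x, fun _ h => h,
      fun _ h _ => h⟩
  · simp only [Expr.cost]
    omega
  · rintro _ ⟨he, n, h, l, rfl, rfl, hl, h₁, h₂⟩
    cases l with
    | nil =>
      obtain rfl : h = 0 := hl
      refine .inl ⟨rfl, ?_⟩
      rw [hg.concat_mem_dict_iff]
      rintro ⟨k, hk, e⟩
      have hk' := mem_children.2 ((hg.entry_eq_iff hk).1 e).1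
      exact List.not_mem_nil (h₂ k hk' ((hletter k hk').2 e))
    | cons k l =>
      obtain ⟨rfl, hl⟩ := hl
      have hk' := h₁ k (by simp)
      rw [hcond k (hlt k hk')] at he
      exact .inr ⟨k, hlt k hk', rfl, (hletter k hk').1 (by simpa using he)⟩

/-! ### Updates of the factorization -/

theorem State.Outputs.update_last {s s' : State} {I : List (LZ78.Id (Fin σ))} {x y : LZ78.Id (Fin σ)}
    (h : s.Outputs (I ++ [x])) (h₁ : s'.reg 1 = s.reg 1)
    (h₃ : s'.arr 3 = Function.update (s.arr 3) I.length (y.word 0))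
    (h₄ : s'.arr 4 = Function.update (s.arr 4) I.length (y.word 1)) : s'.Outputs (I ++ [y]) := by
  refine ⟨by rw [h₁, h.1]; simp, fun i hi => ?_⟩
  rcases Nat.lt_or_ge i I.length with hi' | hi'
  · have := h.2 i (by simp; omega)
    rw [List.getElem_append_left hi'] at this ⊢
    rw [h₃, h₄, Function.update_of_ne hi'.ne, Function.update_of_ne hi'.ne]
    exact this
  · obtain rfl : i = I.length := by simp at hi; omega
    simp [h₃, h₄]

theorem State.Outputs.concat {s s' : State} {I : List (LZ78.Id (Fin σ))} {y : LZ78.Id (Fin σ)}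
    (h : s.Outputs I) (h₁ : s'.reg 1 = s.reg 1 + 1)
    (h₃ : s'.arr 3 = Function.update (s.arr 3) I.length (y.word 0))
    (h₄ : s'.arr 4 = Function.update (s.arr 4) I.length (y.word 1)) : s'.Outputs (I ++ [y]) := by
  refine ⟨by rw [h₁, h.1]; simp, fun i hi => ?_⟩
  rcases Nat.lt_or_ge i I.length with hi' | hi'
  · have := h.2 i hi'
    rw [List.getElem_append_left hi']
    rw [h₃, h₄, Function.update_of_ne hi'.ne, Function.update_of_ne hi'.ne]
    exact this
  · obtain rfl : i = I.length := by simp at hi; omega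
    simp [h₃, h₄]

theorem runs_extendFactor {s : State} {L : List (List (Fin σ))} {cur : List (Fin σ)}
    {I : List (LZ78.Id (Fin σ))} {x : LZ78.Id (Fin σ)} {c : Fin σ} {k : ℕ} (hW : 1 < W)
    (hL : L.length < W) (hg : Greedy L cur I x) (hs : s.Represents L cur I x) (hk : k < L.length) :
    Runs W extendFactor (s.setReg 4 (k + 1)) 25 fun s' =>
      s'.Represents L (cur ++ [c]) I (.entry k) ∧ (∀ r ∉ ({1, 4} : Set ℕ), s'.reg r = s.reg r) ∧
        (∀ b < 3, s'.arr b = s.arr b) ∧ s'.arr 5 = s.arr 5 := by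
  have hr : s.reg 1 = L.length + 1 := by rw [hs.outputs.1]; simp [hg.length_eq]
  have hm : L.length % W = L.length := Nat.mod_eq_of_lt hL
  have hkm : k % W = k := Nat.mod_eq_of_lt (by omega)
  refine Runs.write_seq (T' := 15) (Runs.write_seq (T' := 6) (Runs.assign (by decide) ?_)
    (by decide)) (by decide)
  simp only [Expr.eval, Op.eval, Nat.mod_eq_of_lt hW, State.reg_setReg, State.reg_setArr, hr,
    hm, hkm, if_true, Nat.add_sub_cancel, OfNat.one_ne_ofNat, if_false]
  refine ⟨⟨?_, ?_, ?_, ?_⟩, ?_, ?_, ?_⟩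
  · refine hs.outputs.update_last (by simp) ?_ ?_ <;> simp [hg.length_eq, LZ78.Id.word]
  · intro j hj a ha
    refine hs.letters j hj a ?_
    rcases Nat.lt_or_ge (j + 1) L.length with h | h
    · rw [List.getD_append _ _ _ _ h] at ha ⊢
      exact ha
    · have h' : j + 1 = L.length := by omega
      -- The last entry ends in the first letter of `cur`, which appending `c` does not alter.
      obtain ⟨b, l, rfl⟩ := List.exists_cons_of_ne_nil hg.cur_ne_nil
      simpa [h'] using ha
  · intro u
    have := hs.linked u
    cases u <;> simpa [State.head] using this
  · simp [State.head]
  · intro r hr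
    simp only [Set.mem_insert_iff, Set.mem_singleton_iff, not_or] at hr
    simp [hr]
  · intro b hb
    simp [show b ≠ 3 by omega, show b ≠ 4 by omega]
  · simp

theorem runs_pushChild {s : State} {L : List (List (Fin σ))} {cur : List (Fin σ)}
    {I : List (LZ78.Id (Fin σ))} {x : LZ78.Id (Fin σ)} {b : ℕ} (hW : 1 < W) (hL : L.length < W)
    (hg : Greedy L cur I x) (ho : s.Outputs (I ++ [x])) (hb : b = if x.word 0 = 1 then 7 else 6)
    (hs : ∀ u, Linked (s.arr 8) (s.head u) (children I u)) :
    Runs W (pushChild b) s 20 fun s' => s'.reg = s.reg ∧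
      (∀ b < 6, s'.arr b = s.arr b) ∧ s'.arr 9 = s.arr 9 ∧
      ∀ u, Linked (s'.arr 8) (s'.head u) (children (I ++ [x]) u) := by
  have hr : s.reg 1 = L.length + 1 := by rw [ho.1]; simp [hg.length_eq]
  have hm : L.length % W = L.length := Nat.mod_eq_of_lt hL
  have hx : s.arr 4 L.length = x.word 1 := by
    have := (ho.2 I.length (by simp)).2
    simpa [hg.length_eq] using this
  have hlt : ∀ u, ∀ k ∈ children I u, k ≠ L.length := fun u k hk =>
    (hg.length_eq ▸ (List.getElem?_eq_some_iff.1 (mem_children.1 hk)).1).ne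
  -- The new entry is in no list yet, so writing its sibling cell preserves all lists.
  have h8 : ∀ v u h, Linked (s.arr 8) h (children I u) →
      Linked (Function.update (s.arr 8) L.length v) h (children I u) := fun v u h hl =>
    hl.congr fun k hk => Function.update_of_ne (hlt u k hk) _ _
  refine Runs.write_seq (T' := 8) (Runs.write (by simp [Expr.cost]) ?_) (by simp [Expr.cost])
  have hb6 : 6 ≤ b := by subst hb; split <;> omega
  have hb8 : b < 8 := by subst hb; split <;> omega
  simp only [Expr.eval, Op.eval, Nat.mod_eq_of_lt hW, State.reg_setArr, hr,
    hm, Nat.add_sub_cancel, State.arr_setArr, hx, if_false, Nat.reduceEqDiff]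
  refine ⟨trivial, ?_, ?_, ?_⟩
  · intro b' hb'
    simp [show b' ≠ b by omega, show b' ≠ 8 by omega]
  · simp [show 9 ≠ b by omega]
  · intro u
    by_cases hu : x = u
    · subst hu
      rw [children_concat_self]
      have := h8 (s.head x) x _ (hs x)
      cases x with
      | letter a =>
        obtain rfl : b = 6 := by simpa [LZ78.Id.word] using hb
        simpa [Linked, State.head, hg.length_eq, LZ78.Id.word] using this
      | entry k =>
        obtain rfl : b = 7 := by simpa [LZ78.Id.word] using hb
        simpa [Linked, State.head, hg.length_eq, LZ78.Id.word] using this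
    · rw [children_concat_of_ne hu]
      have := h8 (s.arr b (x.word 1)) u _ (hs u)
      convert this using 1
      · simp [show 8 ≠ b by omega]
      · cases x with
        | letter a =>
          obtain rfl : b = 6 := by simpa [LZ78.Id.word] using hb
          cases u with
          | letter a' =>
            have : (a' : ℕ) ≠ a := fun e => hu (by rw [Fin.val_injective e])
            simp [State.head, LZ78.Id.word, Function.update_of_ne this]
          | entry k' => simp [State.head]
        | entry k =>
          obtain rfl : b = 7 := by simpa [LZ78.Id.word] using hb
          cases u with
          | letter a' => simp [State.head]
          | entry k' =>
            have : k' ≠ k := fun e => hu (by rw [e])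
            simp [State.head, LZ78.Id.word, Function.update_of_ne this]

/-- Used for the very first letter and for every later factor; `I` holds the IDs of the factors
already finished. -/
theorem runs_startFactor {s : State} {L : List (List (Fin σ))} {I : List (LZ78.Id (Fin σ))} {c : Fin σ}
    (hW : I.length + 1 < W) (ho : s.Outputs I) (hc : s.reg 12 = c)
    (hl : ∀ k < L.length, ∀ a, ((L ++ [[c]]).getD (k + 1) []).take 1 = [a] → s.arr 9 k = a)
    (hs : ∀ u, Linked (s.arr 8) (s.head u) (children I u)) :
    Runs W startFactor s 15 fun s' =>
      s'.Represents L [c] I (.letter c) ∧ (∀ r ∉ ({1, 4} : Set ℕ), s'.reg r = s.reg r) ∧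
        (∀ b < 3, s'.arr b = s.arr b) ∧ s'.arr 5 = s.arr 5 := by
  have hr := ho.1
  have hm : (I.length + 1) % W = I.length + 1 := Nat.mod_eq_of_lt hW
  have h1 : 1 % W = 1 := Nat.mod_eq_of_lt (by omega)
  refine Runs.write_seq (T' := 12) (Runs.write_seq (T' := 8) (Runs.assign_seq (T' := 4)
    (Runs.assign (by decide) ?_) (by decide)) (by decide)) (by decide)
  simp only [Expr.eval, Op.eval, h1, Nat.zero_mod, State.reg_setReg, State.reg_setArr, hr,
    hm, if_false, OfNat.one_ne_ofNat, hc]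
  refine ⟨⟨?_, ?_, ?_, ?_⟩, ?_, ?_, ?_⟩
  · refine ho.concat (by simp [hr]) ?_ ?_ <;> simp [LZ78.Id.word]
  · intro k hk a ha
    simpa using hl k hk a ha
  · intro u
    have := hs u
    cases u <;> simpa [State.head] using this
  · simp [State.head]
  · intro r hr
    simp only [Set.mem_insert_iff, Set.mem_singleton_iff, not_or] at hr
    simp [hr]
  · intro b hb
    simp [show b ≠ 3 by omega, show b ≠ 4 by omega]
  · simp

theorem runs_nextFactor {s : State} {L : List (List (Fin σ))} {cur : List (Fin σ)}
    {I : List (LZ78.Id (Fin σ))} {x : LZ78.Id (Fin σ)} {c : Fin σ} (hL : L.length + 2 < W)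
    (hg : Greedy L cur I x) (hs : s.Represents L cur I x) (hc : s.reg 12 = c) :
    Runs W nextFactor (s.setReg 4 0) 60 fun s' =>
      s'.Represents (L ++ [cur]) [c] (I ++ [x]) (.letter c) ∧
        (∀ r ∉ ({1, 4} : Set ℕ), s'.reg r = s.reg r) ∧
        (∀ b < 3, s'.arr b = s.arr b) ∧ s'.arr 5 = s.arr 5 := by
  have hW : 1 < W := by omega
  have hr : s.reg 1 = L.length + 1 := by rw [hs.outputs.1]; simp [hg.length_eq]
  have hm : L.length % W = L.length := Nat.mod_eq_of_lt (by omega)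
  refine Runs.write_seq (T' := 50) ?_ (by decide)
  have he : (Expr.op .sub (.reg 1) (.const 1)).eval W (s.setReg 4 0) = L.length := by
    simp [Expr.eval, Op.eval, Nat.mod_eq_of_lt hW, hr, hm]
  have he' : (Expr.reg 12).eval W (s.setReg 4 0) = c := by simp [Expr.eval, hc]
  rw [he, he']
  have ho : ((s.setReg 4 0).setArr 9 L.length c).Outputs (I ++ [x]) :=
    ⟨by simpa using hs.outputs.1, fun i hi => by simpa using hs.outputs.2 i hi⟩
  have hl : ∀ u : LZ78.Id (Fin σ), Linked (((s.setReg 4 0).setArr 9 L.length c).arr 8)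
      (((s.setReg 4 0).setArr 9 L.length c).head u) (children I u) := by
    intro u
    have := hs.linked u
    cases u <;> simpa [State.head] using this
  have hx : (Expr.read 3 (.op .sub (.reg 1) (.const 1))).eval W
      ((s.setReg 4 0).setArr 9 L.length c) = x.word 0 := by
    have := (ho.2 I.length (by simp)).1
    simp only [Expr.eval, Op.eval, Nat.mod_eq_of_lt hW, State.reg_setArr, State.reg_setReg, hr,
      OfNat.one_ne_ofNat, if_false, Nat.add_sub_cancel, hm]
    simpa [hg.length_eq] using this
  refine Runs.seq (T₁ := 30) (T₂ := 15) (Runs.ite (T' := 20)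
    (fun h' => runs_pushChild hW (by omega) hg ho ?_ hl)
    (fun h' => runs_pushChild hW (by omega) hg ho ?_ hl) (by decide)) ?_ (by decide)
  · rw [hx] at h'
    cases x with
    | letter a => simp [LZ78.Id.word] at h'
    | entry k => simp [LZ78.Id.word]
  · rw [hx] at h'
    rw [h']
    simp
  · rintro s' ⟨h₁, h₂, h₃, h₄⟩
    refine (runs_startFactor (L := L ++ [cur]) (c := c) (by simp [hg.length_eq]; omega) ?_ ?_ ?_ h₄).mono
      le_rfl ?_
    · refine ⟨by rw [h₁]; exact ho.1, fun i hi => ?_⟩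
      rw [h₂ 3 (by decide), h₂ 4 (by decide)]
      exact ho.2 i hi
    · simpa [h₁] using hc
    · intro k hk a ha
      rw [h₃]
      rcases Nat.lt_or_ge k L.length with h | h
      · rw [List.getD_append (L ++ [cur]) _ _ _ (by simp; omega)] at ha
        simpa [Function.update_of_ne h.ne] using hs.letters k h a ha
      -- The newly completed entry ends in the first letter of the new factor, the `c` just stored
      -- in array `9`.
      · obtain rfl : k = L.length := by simp at hk; omega
        have : c = a := by simpa using ha
        simp [this]
    · rintro s'' ⟨q₁, q₂, q₃, q₄⟩
      refine ⟨q₁, fun r hr => ?_, fun b hb => ?_, ?_⟩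
      · rw [q₂ r hr, h₁]
        simp only [Set.mem_insert_iff, Set.mem_singleton_iff, not_or] at hr
        simp [hr]
      · rw [q₃ b hb, h₂ b (by omega)]
        simp [show b ≠ 9 by omega]
      · rw [q₄, h₂ 5 (by decide)]
        simp

/-! ### Correctness and running time -/

theorem State.Represents.congr {s s' : State} {L : List (List (Fin σ))} {cur : List (Fin σ)}
    {I : List (LZ78.Id (Fin σ))} {x : LZ78.Id (Fin σ)} (h : s.Represents L cur I x)
    (h₁ : s'.reg 1 = s.reg 1) (h₄ : s'.reg 4 = s.reg 4) (ha : s'.arr = s.arr) :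
    s'.Represents L cur I x := by
  have hh : ∀ u : LZ78.Id (Fin σ), s'.head u = s.head u := by
    intro u
    cases u <;> simp [State.head, ha]
  refine ⟨⟨h₁.trans h.outputs.1, ?_⟩, ?_, fun u => ?_, ?_⟩
  · rw [ha]; exact h.outputs.2
  · rw [ha]; exact h.letters
  · rw [ha, hh]; exact h.linked u
  · rw [h₄, hh]; exact h.cursor

/-- The invariant of the main loop after `p` letters of the text have been processed. -/
structure State.Parsed (W : ℕ) (G : SLP (Fin σ)) (s : State) (p : ℕ) (L : List (List (Fin σ)))
    (cur : List (Fin σ)) (I : List (LZ78.Id (Fin σ))) (x : LZ78.Id (Fin σ)) : Prop where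
  grammar : s.HasGrammar W G
  pos : s.reg 2 = p
  length : s.reg 3 = G.str.length
  le : p ≤ G.str.length
  flatten : (L ++ [cur]).flatten = G.str.take p
  greedy : Greedy L cur I x
  represents : s.Represents L cur I x

theorem runs_processLetter (hn : G.size < W) (hN : G.str.length < W) {s : State} {p : ℕ}
    {L : List (List (Fin σ))} {cur : List (Fin σ)} {I : List (LZ78.Id (Fin σ))}
    {x : LZ78.Id (Fin σ)} (hs : s.Parsed W G p L cur I x) (hp : p < G.str.length) :
    Runs W processLetter s (200 * G.size) fun s' =>
      ∃ L' cur' I' x', s'.Parsed W G (p + 1) L' cur' I' x' := by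
  have hsize := G.size_pos
  have hW : 1 < W := by omega
  have hg := hs.greedy
  -- Each factor uses up at least one of the `p < N` letters read, so even one more factor leaves
  -- the counter below `W`.
  have hlen : L.length + 1 ≤ p := by
    have := hg.length_le_length_flatten
    rw [hs.flatten, List.length_take] at this
    simp at this
    omega
  have hch : (children I x).length ≤ G.size := by
    refine (hg.length_children_le fun a ha => ?_).trans G.card_letters_le
    rw [hs.flatten] at ha
    exact G.mem_letters_of_mem_val _ _ (List.mem_of_mem_take ha)
  obtain ⟨c, hc⟩ : ∃ c, G.str[p]? = some c := ⟨_, List.getElem?_eq_getElem hp⟩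
  have hflat : (L ++ [cur]).flatten ++ [c] = G.str.take (p + 1) := by
    rw [hs.flatten, List.take_add_one, hc]
    rfl
  have hpm : (p + 1) % W = p + 1 := Nat.mod_eq_of_lt (by omega)
  refine Runs.seq (T₁ := 40 * G.size) (T₂ := 160 * G.size)
    (runs_readLetter hn hN hs.grammar (hs.pos ▸ hc)) ?_ (by omega)
  rintro _ ⟨v, q, rfl⟩
  set s₁ := ((s.setReg 10 v).setReg 11 q).setReg 12 c with hs₁
  have hr : s₁.Represents L cur I x :=
    hs.represents.congr (by simp [hs₁]) (by simp [hs₁]) (by simp [hs₁])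
  have hc₁ : s₁.reg 12 = c := by simp [hs₁]
  have hG₁ : s₁.HasGrammar W G :=
    hs.grammar.congr (by simp [hs₁]) (by simp [hs₁]) (by simp [hs₁])
  have h2 : s₁.reg 2 = p := by simpa [hs₁] using hs.pos
  have h3 : s₁.reg 3 = G.str.length := by simpa [hs₁] using hs.length
  refine Runs.seq (T₁ := 40 * G.size) (T₂ := 120 * G.size)
    ((runs_searchChild hW (by omega) hg hr hc₁).mono (by omega) fun _ h => h) ?_ (by omega)
  intro s₂ hs₂
  refine Runs.seq (T₁ := 65) (T₂ := 4) (Q' := fun s' => (∃ L' cur' I' x',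
      (L' ++ [cur']).flatten = G.str.take (p + 1) ∧ Greedy L' cur' I' x' ∧
      s'.Represents L' cur' I' x') ∧ (∀ r ∉ ({1, 4} : Set ℕ), s'.reg r = s₁.reg r) ∧
      (∀ b < 3, s'.arr b = s₁.arr b) ∧ s'.arr 5 = s₁.arr 5) ?_ ?_ (by omega)
  · rcases hs₂ with ⟨rfl, hnot⟩ | ⟨k, hk, rfl, he⟩
    · refine Runs.ite (T' := 60) (fun h => ?_) (fun _ => ?_) (by decide)
      · simp [Expr.eval] at h
      · refine (runs_nextFactor (by omega) hg hr hc₁).mono le_rfl fun s' h => ⟨?_, h.2⟩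
        exact ⟨_, _, _, _, by rw [← hflat]; simp, hg.next hnot, h.1⟩
    · refine Runs.ite (T' := 60) (fun _ => ?_) (fun h => ?_) (by decide)
      · refine (runs_extendFactor (c := c) hW (by omega) hg hr hk).mono (by omega)
          fun s' h => ⟨?_, h.2⟩
        exact ⟨_, _, _, _, by rw [← hflat]; simp, hg.extend hk he, h.1⟩
      · simp [Expr.eval] at h
  · rintro s' ⟨⟨L', cur', I', x', q₁, q₂, q₃⟩, hreg, h₁, h₅⟩
    have r0 := hreg 0 (by simp)
    have r2 := hreg 2 (by simp)
    have r3 := hreg 3 (by simp)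
    refine Runs.assign (by decide) ⟨L', cur', I', x', ?_, ?_, ?_, hp, q₁, q₂, ?_⟩
    · exact hG₁.congr (by simpa using r0) (by simpa using h₁) (by simpa using h₅)
    · simp [Expr.eval, Op.eval, r2, h2, Nat.mod_eq_of_lt hW, hpm]
    · simpa [r3] using h3
    · exact q₃.congr (by simp) (by simp) (by simp)

theorem runs_lz78 (hn : G.size < W) (hN : G.str.length < W) :
    Runs W lz78 G.initState (1000 * (G.size * G.str.length)) fun s =>
      ∃ L cur I x, s.Parsed W G G.str.length L cur I x := by
  have hsize := G.size_pos
  have hpos := G.str_length_pos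
  have hW : 1 < W := by omega
  have h1 : 1 % W = 1 := Nat.mod_eq_of_lt hW
  have hmul : G.size ≤ G.size * G.str.length := Nat.le_mul_of_pos_right _ hpos
  obtain ⟨c, hc⟩ : ∃ c, G.str[0]? = some c := ⟨_, List.getElem?_eq_getElem hpos⟩
  refine Runs.seq (T₁ := 40 * G.size) (T₂ := 800 * (G.size * G.str.length))
    (runs_computeLengths hn) ?_ (by omega)
  rintro s ⟨hG, hreg, harr⟩
  refine Runs.assign_seq (T' := 700 * (G.size * G.str.length)) ?_ (by simp only [Expr.cost]; omega)
  have he : (Expr.read 5 (.op .sub (.reg 0) (.const 1))).eval W s = G.str.length := by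
    simp only [Expr.eval, Op.eval, hG.size, h1, Nat.mod_eq_of_lt (show G.size - 1 < W by omega)]
    rw [hG.lengths (G.size - 1) (by omega)]
    exact Nat.mod_eq_of_lt hN
  rw [he]
  have hG' : (s.setReg 3 G.str.length).HasGrammar W G := hG.congr (by simp) (by simp) (by simp)
  have hreg' : ∀ x ≠ 5, x ≠ 0 → s.reg x = 0 := fun x h₅ h₀ => by
    rw [hreg x h₅]; simp [SLP.initState, h₀]
  have harr' : ∀ b ≠ 5, 3 ≤ b → s.arr b = fun _ => 0 := fun b h₅ h₃ => by
    rw [harr b h₅]; funext i; simp [SLP.initState, show ¬ b < 3 by omega]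
  refine Runs.seq (T₁ := 40 * G.size) (T₂ := 600 * (G.size * G.str.length))
    (runs_readLetter hn hN hG' (a := c) (by simpa [hreg'] using hc)) ?_ (by omega)
  rintro _ ⟨v, q, rfl⟩
  set s₁ := (((s.setReg 3 G.str.length).setReg 10 v).setReg 11 q).setReg 12 c with hs₁
  refine Runs.seq (T₁ := 15) (T₂ := 500 * (G.size * G.str.length))
    (runs_startFactor (L := []) (I := []) (c := c) (by simpa using hW) ?_ (by simp [hs₁]) (by simp)
      ?_) ?_ (by omega)
  · exact ⟨by simp [hs₁, hreg'], by simp⟩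
  -- Untouched memory is `0`, the null pointer, so all lists of children start empty.
  · intro u
    cases u <;> simp [hs₁, State.head, children, Linked, harr']
  rintro s₂ ⟨hrep, hr, h₁, h₅⟩
  refine Runs.assign_seq (T' := 410 * (G.size * G.str.length)) ?_ (by simp only [Expr.cost]; omega)
  have hstart : (s₂.setReg 2 1).Parsed W G 1 [] [c] [] (.letter c) := by
    refine ⟨?_, by simp, ?_, hpos, ?_, greedy_singleton c,
      hrep.congr (by simp) (by simp) (by simp)⟩
    · exact hG'.congr (by simpa [hs₁] using hr 0 (by simp)) (by simpa [hs₁] using h₁)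
        (by simpa [hs₁] using h₅)
    · simpa [hs₁] using hr 3 (by simp)
    · rw [show 1 = 0 + 1 from rfl, List.take_add_one, hc]
      simp
  have e1 : (Expr.const 1).eval W s₂ = 1 := h1
  rw [e1]
  refine (Runs.while (T := 200 * G.size) (I := fun k s => ∃ p, k = G.str.length - p ∧
    ∃ L cur I x, s.Parsed W G p L cur I x) ?_ (G.str.length - 1) _
    ⟨1, rfl, _, _, _, _, hstart⟩).mono ?_ ?_
  · rintro k s ⟨p, rfl, L, cur, I, x, h⟩ he
    simp only [Expr.eval, Op.eval, ite_mod hW, h.pos, h.length, ne_eq, ite_eq_right_iff,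
      one_ne_zero, imp_false, not_not] at he
    refine (runs_processLetter hn hN h he).mono le_rfl fun s' h' => ?_
    exact ⟨G.str.length - (p + 1), by omega, p + 1, rfl, h'⟩
  · rw [Nat.sub_add_cancel hpos]
    simp only [Expr.cost]
    nlinarith
  · rintro s ⟨he, k, p, -, L, cur, I, x, h⟩
    simp only [Expr.eval, Op.eval, ite_mod hW, h.pos, h.length, ite_eq_right_iff,
      one_ne_zero, imp_false, not_lt] at he
    obtain rfl : p = G.str.length := le_antisymm h.le he
    exact ⟨L, cur, I, x, h⟩

end RAM

theorem theorem18 :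
    ∃ (P : RAM.Cmd) (C : ℕ), ∀ (σ w : ℕ) (G : SLP (Fin σ)),
      σ ≤ 2 ^ w → G.size < 2 ^ w → G.str.length < 2 ^ w →
        ∃ (fs : List (List (Fin σ))) (ids : List (LZ78.Id (Fin σ))),
          LZ78.IsFactorization G.str fs ∧ LZ78.IsEncoding fs ids ∧
            ∃ (s : RAM.State) (t : ℕ),
              RAM.Exec (2 ^ w) P G.initState s t ∧ s.Outputs ids ∧
                t ≤ C * (G.size ^ 3 * fs.length ^ 2) := by
  refine ⟨RAM.lz78, 1000, fun σ w G _ hn hN => ?_⟩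
  obtain ⟨s, t, hex, ht, L, cur, I, x, h⟩ := RAM.runs_lz78 hn hN
  have hflat : (L ++ [cur]).flatten = G.str := by rw [h.flatten, List.take_length]
  refine ⟨L ++ [cur], I ++ [x], hflat ▸ h.greedy.isFactorization, h.greedy.encoding, s, t, hex,
    h.represents.outputs, ht.trans ?_⟩
  have hle := h.greedy.length_flatten_le
  rw [hflat] at hle
  -- Combines `n ≤ n ^ 3` with `N ≤ m ^ 2`.
  exact Nat.mul_le_mul_left _ (Nat.mul_le_mul (Nat.le_self_pow three_ne_zero _) hle)
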